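/- Let $H$ be the space of continuous functions $p:\mathbb R\to\mathbb R$ of period one with $\int_0^1 p(x)\,dx=0$ (with the sup norm and its Borel $\sigma$-algebra), and for $p\in H$ put $$A(p)=\int_0^1 e^{2\int_0^x p(x')\,dx'}\,dx\;\times\;\int_0^1 e^{-2\int_0^x p(x')\,dx'}\,dx .$$ Let $P_0$ be the probability measure on $H$ given by circular Brownian motion conditioned to have mean zero, that is, the law of $b-\int_0^1 b(x)\,dx$, where $b$ is the standard Brownian bridge of length one from $0$ to $0$ (the centred continuous Gaussian process on $[0,1]$ with covariance $E[b(s)b(t)]=\min(s,t)-st$, extended with period one). Then $$\limsup_{\mu\to+\infty}\ \mu^{-3/2}\,\log\int_H \exp\Bigl\{-\tfrac12\int_0^1\bigl(\mu-p^2(x)\bigr)^2dx\Bigr\}\,A(p)\,dP_0(p)\ \le\ -\frac83 .$$ -/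

import Mathlib

open MeasureTheory ProbabilityTheory

/-- Continuous functions of period one (continuous functions on the circle `ℝ/ℤ`), with the
sup-norm topology, carry the Borel sigma-algebra. -/
instance instMeasurableSpaceLoop : MeasurableSpace C(UnitAddCircle, ℝ) := borel _

instance instBorelSpaceLoop : BorelSpace C(UnitAddCircle, ℝ) := ⟨rfl⟩

/-- The average `∫₀¹ p(x) dx` of a continuous function of period one. -/
noncomputable def loopMean (p : C(UnitAddCircle, ℝ)) : ℝ := ∫ x in (0 : ℝ)..1, p (x : UnitAddCircle)

/-- `H`: the continuous functions of period one and mean zero. -/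
abbrev MeanZeroLoop : Type := {p : C(UnitAddCircle, ℝ) // loopMean p = 0}

theorem intervalIntegrable_loop (p : C(UnitAddCircle, ℝ)) :
    IntervalIntegrable (fun x : ℝ => p (x : UnitAddCircle)) volume 0 1 :=
  (p.continuous.comp (AddCircle.continuous_mk' 1)).intervalIntegrable 0 1

theorem loopMean_sub_const (p : C(UnitAddCircle, ℝ)) :
    loopMean (p - ContinuousMap.const _ (loopMean p)) = 0 := by
  have h : loopMean (p - ContinuousMap.const _ (loopMean p))
      = ∫ x in (0 : ℝ)..1, (p (x : UnitAddCircle) - loopMean p) := rfl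
  rw [h, intervalIntegral.integral_sub (intervalIntegrable_loop p) (by simp)]
  simp [loopMean]

/-- The map `p ↦ p - ∫₀¹ p`. -/
noncomputable def centerLoop (p : C(UnitAddCircle, ℝ)) : MeanZeroLoop :=
  ⟨p - ContinuousMap.const _ (loopMean p), loopMean_sub_const p⟩

theorem continuous_loopMean : Continuous loopMean := by
  refine intervalIntegral.continuous_parametric_intervalIntegral_of_continuous' ?_ 0 1
  exact continuous_eval.comp
    (continuous_fst.prodMk ((AddCircle.continuous_mk' 1).comp continuous_snd))

theorem measurable_centerLoop : Measurable centerLoop := by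
  refine Continuous.measurable (Continuous.subtype_mk ?_ _)
  exact continuous_id.sub (ContinuousMap.continuous_const'.comp continuous_loopMean)

/-- `ν` is the law `BM₀₀` of the standard Brownian bridge of length one from `0` to `0`, realised
on the continuous paths `b` with `b 0 = b 1`: under `ν` the coordinates `b(t)`, `0 ≤ t ≤ 1`, form a
centred Gaussian process with covariance `min s t - s t`. As a Borel measure on continuous paths
is determined by its finite-dimensional distributions, this describes exactly one measure. -/
structure IsBrownianBridgeLaw (ν : Measure C(UnitAddCircle, ℝ)) : Prop where
  gaussian : IsGaussianProcess
    (fun (t : Set.Icc (0 : ℝ) 1) (b : C(UnitAddCircle, ℝ)) => b ((t : ℝ) : UnitAddCircle)) ν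
  mean_eq_zero : ∀ t ∈ Set.Icc (0 : ℝ) 1,
    ∫ b : C(UnitAddCircle, ℝ), b (t : UnitAddCircle) ∂ν = 0
  covariance_eq : ∀ s ∈ Set.Icc (0 : ℝ) 1, ∀ t ∈ Set.Icc (0 : ℝ) 1,
    cov[fun b : C(UnitAddCircle, ℝ) => b (s : UnitAddCircle),
      fun b : C(UnitAddCircle, ℝ) => b (t : UnitAddCircle); ν] = min s t - s * t

/-- `P₀`, the circular Brownian motion conditioned to have mean zero: the law on `H` of
`b - ∫₀¹ b`, where `b` is the Brownian bridge with law `ν`. (Circular Brownian motion is the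
law of `b + c` with `c` spread over the line according to a multiple of Lebesgue measure `dc`;
by translation invariance of `dc` its mean and its centring `b - ∫₀¹ b` decouple,
so that conditioning the mean to be `0` leaves the law of `b - ∫₀¹ b`.) -/
noncomputable def meanZeroCBM (ν : Measure C(UnitAddCircle, ℝ)) : Measure MeanZeroLoop :=
  ν.map centerLoop

/-- `A(p) = ∫₀¹ exp(2 ∫₀ˣ p) dx · ∫₀¹ exp(-2 ∫₀ˣ p) dx`. -/
noncomputable def hillA (p : MeanZeroLoop) : ℝ :=
  (∫ x in (0 : ℝ)..1, Real.exp (2 * ∫ y in (0 : ℝ)..x, p.1 (y : UnitAddCircle))) *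
    ∫ x in (0 : ℝ)..1, Real.exp (-2 * ∫ y in (0 : ℝ)..x, p.1 (y : UnitAddCircle))

/-- The integral `∫_H exp(-½ ∫₀¹ (μ - p²)²) A(p) dP` of a nonnegative function, as an element of
`[0, ∞]`. -/
noncomputable def hillIntegral (P : Measure MeanZeroLoop) (μ : ℝ) : ENNReal :=
  ∫⁻ p : MeanZeroLoop, ENNReal.ofReal
    (Real.exp (-(1 / 2) * ∫ x in (0 : ℝ)..1, (μ - p.1 (x : UnitAddCircle) ^ 2) ^ 2) * hillA p) ∂P

/-! Put μ = r². Heuristically `P₀` has density exp(-½∫p'²), so the integral is governed by the least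
action ½∫p'² + ½∫(r² - p²)². A loop of mean zero cannot stay in one of the wells ±r. It either pays
a potential energy of order r⁴ or goes from one well to the other and back. Since the action is at
least ∫|p'||r² - p²|, it dominates the total variation of r²p - p³/3, and the round trip costs 2 ·
(4/3)r³.

Brownian paths have no Dirichlet energy, so the argument runs on a grid of n ≈ 2r/ε points, with
discrete energy E and potential V. On a good path E + V ≥ m ≈ (8/3)r³
(`min_le_gridEnergy_add_gridPotential`), hence exp(-(1-ε)V) ≤ exp(-(1-ε)m) exp((1-ε)E). The last
factor has expectation at most ε^(-n/2) = exp(O(r))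
(`IsBrownianBridgeLaw.lintegral_exp_gridEnergy_le`), negligible against exp(r³).

Riemann sums replace the integral without error: it equals their average over all shifts of the
grid, and Jensen's inequality moves this average outside the exponential. The mean on one shifted
grid need not vanish, but it is sub-Gaussian of variance 1/n
(`IsBrownianBridgeLaw.lintegral_exp_gridMean_le`), so large values are too rare to matter. The
weight A is absorbed by a fraction ε of the potential at cost exp(O(r²)) (`exp_mul_hillA_le`).
Finally ε tends to 0. -/

/-! ### Double-well energy of lattice functions on a circle -/

/-- Along a closed chain, the total variation is at least twice any difference of values. -/
theorem two_mul_abs_sub_le_sum_abs_sub {n : ℕ} (f : ℕ → ℝ) (hf : f n = f 0) {j k : ℕ}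
    (hj : j < n) (hk : k < n) :
    2 * |f j - f k| ≤ ∑ i ∈ Finset.range n, |f (i + 1) - f i| := by
  wlog hjk : j ≤ k generalizing j k
  · rw [abs_sub_comm]
    exact this hk hj (by omega)
  have h1 := dist_le_Ico_sum_dist f hjk
  have h2 := dist_le_Ico_sum_dist f hk.le
  have h3 := dist_le_Ico_sum_dist f (Nat.zero_le j)
  have h4 : ∑ i ∈ Finset.range n, |f (i + 1) - f i| = ∑ i ∈ Finset.Ico 0 j, dist (f i) (f (i + 1))
      + ∑ i ∈ Finset.Ico j k, dist (f i) (f (i + 1))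
      + ∑ i ∈ Finset.Ico k n, dist (f i) (f (i + 1)) := by
    rw [Finset.sum_Ico_consecutive _ (Nat.zero_le j) hjk,
      Finset.sum_Ico_consecutive _ (Nat.zero_le k) hk.le, Finset.range_eq_Ico]
    exact Finset.sum_congr rfl fun i _ => by rw [Real.dist_eq, abs_sub_comm]
  -- The pieces before `j` and after `k` join up through `f n = f 0` and form a second path between
  -- `f j` and `f k`.
  have h5 := dist_triangle (f k) (f n) (f j)
  rw [hf] at h5 h2
  rw [h4, two_mul, ← Real.dist_eq]
  rw [dist_comm (f k) (f j)] at h5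
  linarith

/-- The primitive `q - q³/3` of `1 - q²`. -/
noncomputable def wellPrimitive (q : ℝ) : ℝ := q - q ^ 3 / 3

/-- Truncation of a real number to `[-1, 1]`. -/
noncomputable def unitClip (q : ℝ) : ℝ := max (-1) (min 1 q)

theorem abs_unitClip_le (q : ℝ) : |unitClip q| ≤ 1 := by
  rw [abs_le]
  exact ⟨le_max_left _ _, max_le (by norm_num) (min_le_left _ _)⟩

theorem abs_unitClip_sub_le (x y : ℝ) : |unitClip y - unitClip x| ≤ |y - x| :=
  (abs_max_sub_max_le_max _ _ _ _).trans <| max_le (by simp) <|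
    (abs_min_sub_min_le_max _ _ _ _).trans <| max_le (by simp) le_rfl

theorem one_sub_unitClip_sq_le (q : ℝ) : 1 - unitClip q ^ 2 ≤ |1 - q ^ 2| := by
  unfold unitClip
  rcases le_total q 1 with h | h
  · rw [min_eq_right h]
    rcases le_total (-1) q with h' | h'
    · rw [max_eq_right h']
      exact le_abs_self _
    · rw [max_eq_left h']
      norm_num
  · rw [min_eq_left h]
    norm_num

/-- A discrete chain rule: the derivative at the left endpoint, with a quadratic error. The slope
exceeds 1 - x² by (x - y)(2x + y)/3, and |2x + y| ≤ 3 on [-1, 1]. -/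
theorem abs_wellPrimitive_sub_le {x y : ℝ} (hx : |x| ≤ 1) (hy : |y| ≤ 1) :
    |wellPrimitive y - wellPrimitive x| ≤ |y - x| * (1 - x ^ 2) + (y - x) ^ 2 := by
  rw [abs_le] at hx hy
  have h : wellPrimitive y - wellPrimitive x = (y - x) * (1 - (x ^ 2 + x * y + y ^ 2) / 3) := by
    unfold wellPrimitive; ring
  have h0 : 0 ≤ 1 - (x ^ 2 + x * y + y ^ 2) / 3 := by nlinarith
  have h1 : 1 - (x ^ 2 + x * y + y ^ 2) / 3 ≤ 1 - x ^ 2 + |y - x| := by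
    rcases le_total x y with h | h
    · rw [abs_of_nonneg (by linarith)]
      nlinarith
    · rw [abs_of_nonpos (by linarith)]
      nlinarith
  rw [h, abs_mul, abs_of_nonneg h0, ← sq_abs (y - x)]
  nlinarith [abs_nonneg (y - x)]

/-- The Modica–Mortola inequality |Δq||1 - q²| ≤ κ/2 Δq² + (1 - q²)²/(2κ), on the lattice. Clipping
confines the chain rule to [-1, 1] without increasing either factor; the additional 1 in κ/2 + 1 is
the discretisation error. -/
theorem abs_wellPrimitive_unitClip_sub_le {κ : ℝ} (hκ : 0 < κ) (x y : ℝ) :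
    |wellPrimitive (unitClip y) - wellPrimitive (unitClip x)| ≤
      (κ / 2 + 1) * (y - x) ^ 2 + 1 / (2 * κ) * (1 - x ^ 2) ^ 2 := by
  have h1 := abs_wellPrimitive_sub_le (abs_unitClip_le x) (abs_unitClip_le y)
  have h2 := abs_unitClip_sub_le x y
  have h3 := one_sub_unitClip_sq_le x
  have h4 : 0 ≤ 1 - unitClip x ^ 2 := by
    nlinarith [abs_unitClip_le x, abs_nonneg (unitClip x), sq_abs (unitClip x)]
  have h5 : (unitClip y - unitClip x) ^ 2 ≤ (y - x) ^ 2 := sq_le_sq.2 h2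
  have h6 : |unitClip y - unitClip x| * (1 - unitClip x ^ 2) ≤ |y - x| * |1 - x ^ 2| :=
    mul_le_mul h2 h3 h4 (abs_nonneg _)
  have h7 : |y - x| * |1 - x ^ 2| ≤ κ / 2 * (y - x) ^ 2 + 1 / (2 * κ) * (1 - x ^ 2) ^ 2 := by
    rw [← sq_abs (y - x), ← sq_abs (1 - x ^ 2)]
    generalize |y - x| = a
    generalize |1 - x ^ 2| = b
    have : κ / 2 * a ^ 2 + 1 / (2 * κ) * b ^ 2 - a * b = (κ * a - b) ^ 2 / (2 * κ) := by
      field_simp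
      ring
    have : 0 ≤ (κ * a - b) ^ 2 / (2 * κ) := by positivity
    linarith
  linarith

/-- The primitive has a critical point at the well 1, so missing the well by ε changes its value 2/3
only to second order. -/
theorem wellPrimitive_unitClip_ge {ε q : ℝ} (hε : 0 ≤ ε) (hq : 1 - ε ≤ q) :
    2 / 3 - ε ^ 2 ≤ wellPrimitive (unitClip q) := by
  have h1 : 1 - ε ≤ unitClip q := le_max_of_le_right (le_min (by linarith) hq)
  have h2 := (abs_le.1 (abs_unitClip_le q)).2
  unfold wellPrimitive
  generalize unitClip q = r at *
  nlinarith [mul_nonneg (sub_nonneg.2 h2) (sub_nonneg.2 h1), sq_nonneg (1 - r),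
    mul_nonneg (sub_nonneg.2 h2) (sub_nonneg.2 h2)]

theorem wellPrimitive_unitClip_neg (q : ℝ) :
    wellPrimitive (unitClip (-q)) = -wellPrimitive (unitClip q) := by
  have h : unitClip (-q) = -unitClip q := by
    unfold unitClip
    rcases le_total q 1 with h | h <;> rcases le_total (-1) q with h' | h' <;>
      simp only [min_def, max_def] <;> split_ifs <;> linarith
  rw [h]
  unfold wellPrimitive
  ring

/-- If a lattice function of small mean stays below `1 - ε`, its potential energy is of the
order of the number of sites. -/
theorem le_sum_well_of_lt {n : ℕ} {ε : ℝ} (hε : 0 < ε) (hε1 : ε ≤ 1 / 2) (q : ℕ → ℝ)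
    (hmean : -(n / 4 : ℝ) ≤ ∑ i ∈ Finset.range n, q i)
    (hq : ∀ i ∈ Finset.range n, q i < 1 - ε) :
    n * ε ^ 2 / 8 ≤ ∑ i ∈ Finset.range n, (1 - q i ^ 2) ^ 2 := by
  -- A minorant linear in q lets the mean enter: it is nonpositive for q ≤ -1/2, and at most ε²
  -- elsewhere, where 1 - q² ≥ ε. Its sum is at least ε²/2 · (n/2 - n/4).
  have h : ∀ i ∈ Finset.range n, ε ^ 2 / 2 * (q i + 1 / 2) ≤ (1 - q i ^ 2) ^ 2 := by
    intro i hi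
    have h1 := hq i hi
    rcases le_total (q i) (-1 / 2) with h2 | h2
    · exact (mul_nonpos_of_nonneg_of_nonpos (by positivity) (by linarith)).trans (sq_nonneg _)
    · have h3 : ε ≤ 1 - q i ^ 2 := by nlinarith
      calc ε ^ 2 / 2 * (q i + 1 / 2) ≤ ε ^ 2 / 2 * 2 := by
            gcongr
            linarith
        _ = ε ^ 2 := by ring
        _ ≤ _ := by gcongr
  refine le_trans ?_ (Finset.sum_le_sum h)
  rw [← Finset.mul_sum, Finset.sum_add_distrib]
  simp only [Finset.sum_const, Finset.card_range, nsmul_eq_mul]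
  nlinarith [sq_pos_of_pos hε]

/-- Lower bound for the energy of a lattice function on a circle whose mean is small: it either
makes two transitions between the wells `±1`, or has large potential energy. -/
theorem min_le_lattice_energy {n : ℕ} {ε κ : ℝ} (hε : 0 < ε) (hε1 : ε ≤ 1 / 2)
    (hκ : 2 / ε ≤ κ) (q : ℕ → ℝ) (hper : q n = q 0)
    (hmean : |∑ i ∈ Finset.range n, q i| ≤ n / 4) :
    min ((1 - ε) * (8 / 3 - 4 * ε ^ 2)) (n * ε ^ 2 / (16 * κ)) ≤
      κ / 2 * ∑ i ∈ Finset.range n, (q (i + 1) - q i) ^ 2 +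
        1 / (2 * κ) * ∑ i ∈ Finset.range n, (1 - q i ^ 2) ^ 2 := by
  have hκ0 : 0 < κ := lt_of_lt_of_le (by positivity) hκ
  have hkin : 0 ≤ κ / 2 * ∑ i ∈ Finset.range n, (q (i + 1) - q i) ^ 2 := by positivity
  have hpot : 0 ≤ 1 / (2 * κ) * ∑ i ∈ Finset.range n, (1 - q i ^ 2) ^ 2 := by positivity
  have large : n * ε ^ 2 / 8 ≤ ∑ i ∈ Finset.range n, (1 - q i ^ 2) ^ 2 →
      n * ε ^ 2 / (16 * κ) ≤ 1 / (2 * κ) * ∑ i ∈ Finset.range n, (1 - q i ^ 2) ^ 2 := by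
    intro h
    calc n * ε ^ 2 / (16 * κ) = 1 / (2 * κ) * (n * ε ^ 2 / 8) := by field_simp; ring
      _ ≤ _ := by gcongr
  by_cases hup : ∀ i ∈ Finset.range n, q i < 1 - ε
  · have := large (le_sum_well_of_lt hε hε1 q (neg_le_of_abs_le hmean) hup)
    exact (min_le_right _ _).trans (by linarith)
  by_cases hdn : ∀ i ∈ Finset.range n, -q i < 1 - ε
  · have h := le_sum_well_of_lt hε hε1 (fun i => -q i)
      (by rw [Finset.sum_neg_distrib]; linarith [le_of_abs_le hmean]) hdn
    simp only [neg_sq] at h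
    exact (min_le_right _ _).trans (by linarith [large h])
  push Not at hup hdn
  obtain ⟨j, hj, hqj⟩ := hup
  obtain ⟨k, hk, hqk⟩ := hdn
  refine (min_le_left _ _).trans ?_
  have hTV := two_mul_abs_sub_le_sum_abs_sub (fun i => wellPrimitive (unitClip (q i)))
    (by simp only [hper]) (Finset.mem_range.1 hj) (Finset.mem_range.1 hk)
  have h1 := wellPrimitive_unitClip_ge hε.le hqj
  have h2 := wellPrimitive_unitClip_ge hε.le hqk
  rw [wellPrimitive_unitClip_neg] at h2
  have h3 := le_abs_self (wellPrimitive (unitClip (q j)) - wellPrimitive (unitClip (q k)))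
  have h4 := hTV.trans (Finset.sum_le_sum fun i _ =>
    abs_wellPrimitive_unitClip_sub_le hκ0 (q i) (q (i + 1)))
  rw [Finset.sum_add_distrib, ← Finset.mul_sum, ← Finset.mul_sum] at h4
  have h5 : 2 ≤ ε * κ := by rwa [div_le_iff₀' hε] at hκ
  generalize ∑ i ∈ Finset.range n, (q (i + 1) - q i) ^ 2 = S at *
  generalize 1 / (2 * κ) * ∑ i ∈ Finset.range n, (1 - q i ^ 2) ^ 2 = T at *
  -- As κ ≥ 2/ε, the discretisation error S is at most the fraction ε of the kinetic term. The
  -- factor 1 + ε is then removed by (1 - ε)(1 + ε) ≤ 1.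
  have h6 : 8 / 3 - 4 * ε ^ 2 ≤ (1 + ε) * (κ / 2 * S + T) := by
    have : S ≤ ε * (κ / 2 * S) := by
      have : 0 ≤ S := by
        by_contra hS
        nlinarith
      nlinarith
    nlinarith
  have h7 : 0 ≤ κ / 2 * S + T := by linarith
  nlinarith [mul_le_mul_of_nonneg_left h6 (by linarith : 0 ≤ 1 - ε), mul_nonneg (sq_nonneg ε) h7]

/-! ### Shifted grids and exact Riemann sums -/

/-- The values of a loop on the grid of mesh `1 / n` translated by `s / n`. -/
noncomputable def gridValue (n : ℕ) (s : ℝ) (p : C(UnitAddCircle, ℝ)) (i : ℕ) : ℝ :=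
  p (((i + s) / n : ℝ) : UnitAddCircle)

/-- The discretised Dirichlet energy of a loop. -/
noncomputable def gridEnergy (n : ℕ) (s : ℝ) (p : C(UnitAddCircle, ℝ)) : ℝ :=
  n / 2 * ∑ i ∈ Finset.range n, (gridValue n s p (i + 1) - gridValue n s p i) ^ 2

/-- The discretised double well potential of a loop. -/
noncomputable def gridPotential (μ : ℝ) (n : ℕ) (s : ℝ) (p : C(UnitAddCircle, ℝ)) : ℝ :=
  (∑ i ∈ Finset.range n, (μ - gridValue n s p i ^ 2) ^ 2 / 2) / n

/-- The discretised mean of a loop. -/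
noncomputable def gridMean (n : ℕ) (s : ℝ) (p : C(UnitAddCircle, ℝ)) : ℝ :=
  (∑ i ∈ Finset.range n, gridValue n s p i) / n

theorem gridValue_period {n : ℕ} (hn : 0 < n) (s : ℝ) (p : C(UnitAddCircle, ℝ)) :
    gridValue n s p n = gridValue n s p 0 := by
  have h : ((n + s) / n : ℝ) = ((0 : ℕ) + s) / n + 1 := by
    field_simp
    push_cast
    ring
  unfold gridValue
  rw [h, AddCircle.coe_add, AddCircle.coe_period, add_zero]

theorem continuous_gridValue (n : ℕ) (i : ℕ) :
    Continuous fun x : ℝ × C(UnitAddCircle, ℝ) => gridValue n x.1 x.2 i := by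
  refine continuous_eval.comp (continuous_snd.prodMk ((AddCircle.continuous_mk' 1).comp ?_))
  fun_prop

theorem continuous_gridMean (n : ℕ) :
    Continuous fun x : ℝ × C(UnitAddCircle, ℝ) => gridMean n x.1 x.2 :=
  (continuous_finsetSum _ fun i _ => continuous_gridValue n i).div_const _

theorem continuous_gridEnergy (n : ℕ) :
    Continuous fun x : ℝ × C(UnitAddCircle, ℝ) => gridEnergy n x.1 x.2 :=
  (continuous_finsetSum _ fun i _ =>
    ((continuous_gridValue n (i + 1)).sub (continuous_gridValue n i)).pow 2).const_mul _

theorem continuous_gridPotential (μ : ℝ) (n : ℕ) :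
    Continuous fun x : ℝ × C(UnitAddCircle, ℝ) => gridPotential μ n x.1 x.2 :=
  (continuous_finsetSum _ fun i _ =>
    ((continuous_const.sub ((continuous_gridValue n i).pow 2)).pow 2).div_const _).div_const _

theorem continuous_loop (p : C(UnitAddCircle, ℝ)) :
    Continuous fun x : ℝ => p (x : UnitAddCircle) :=
  p.continuous.comp (AddCircle.continuous_mk' 1)

theorem continuous_along_shift {β : Type*} [TopologicalSpace β]
    {f : ℝ × C(UnitAddCircle, ℝ) → β} (hf : Continuous f) (p : C(UnitAddCircle, ℝ)) :
    Continuous fun s => f (s, p) :=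
  hf.comp (continuous_id.prodMk continuous_const)

/-- An integral over `[0, 1]` is the average over the shift of its Riemann sums. -/
theorem integral_eq_integral_riemann_sum {f : ℝ → ℝ} (hf : Continuous f) {n : ℕ} (hn : 0 < n) :
    ∫ x in (0 : ℝ)..1, f x =
      ∫ s in (0 : ℝ)..1, (∑ i ∈ Finset.range n, f ((i + s) / n)) / n := by
  have hn' : (n : ℝ) ≠ 0 := by positivity
  have h : ∀ i : ℕ, ∫ s in (0 : ℝ)..1, f ((i + s) / n) =
      n * ∫ x in (i / n : ℝ)..((i + 1 : ℕ) / n : ℝ), f x := by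
    intro i
    have := intervalIntegral.integral_comp_div_add (a := 0) (b := 1) f hn' ((i : ℝ) / n)
    simp only [zero_div, zero_add, smul_eq_mul] at this
    have e : ∀ s : ℝ, (i + s) / n = s / n + i / n := fun s => by ring
    simp only [e, Nat.cast_add, Nat.cast_one]
    exact this
  rw [intervalIntegral.integral_div, intervalIntegral.integral_finsetSum
    fun i _ => Continuous.intervalIntegrable (by fun_prop) _ _]
  simp only [h]
  rw [← Finset.mul_sum, intervalIntegral.sum_integral_adjacent_intervals
    fun k _ => hf.intervalIntegrable _ _]
  simp [hn']

/-- Jensen's inequality for the exponential function on `[0, 1]`. -/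
theorem exp_integral_le {f : ℝ → ℝ} (hf : Continuous f) :
    Real.exp (∫ x in (0 : ℝ)..1, f x) ≤ ∫ x in (0 : ℝ)..1, Real.exp (f x) := by
  have hp : IsProbabilityMeasure (volume.restrict (Set.Ioc (0 : ℝ) 1)) := ⟨by simp⟩
  rw [intervalIntegral.integral_of_le zero_le_one, intervalIntegral.integral_of_le zero_le_one]
  refine convexOn_exp.map_integral_le Real.continuous_exp.continuousOn isClosed_univ (by simp) ?_ ?_
  · exact (hf.intervalIntegrable 0 1).1
  · exact ((Real.continuous_exp.comp hf).intervalIntegrable 0 1).1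

theorem integral_eq_integral_gridPotential (μ : ℝ) {n : ℕ} (hn : 0 < n)
    (p : C(UnitAddCircle, ℝ)) :
    1 / 2 * ∫ x in (0 : ℝ)..1, (μ - p (x : UnitAddCircle) ^ 2) ^ 2 =
      ∫ s in (0 : ℝ)..1, gridPotential μ n s p := by
  have hc := continuous_loop p
  have h := integral_eq_integral_riemann_sum
    (f := fun x : ℝ => 1 / 2 * (μ - p (x : UnitAddCircle) ^ 2) ^ 2) (by fun_prop) hn
  rw [← intervalIntegral.integral_const_mul, h]
  unfold gridPotential gridValue
  refine intervalIntegral.integral_congr fun s _ => ?_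
  congr 1
  exact Finset.sum_congr rfl fun i _ => by ring

theorem loopMean_eq_integral_gridMean {n : ℕ} (hn : 0 < n) (p : C(UnitAddCircle, ℝ)) :
    loopMean p = ∫ s in (0 : ℝ)..1, gridMean n s p :=
  integral_eq_integral_riemann_sum (continuous_loop p) hn

/-! ### Absorbing the weight A into the potential -/

theorem abs_integral_loop_le (p : C(UnitAddCircle, ℝ)) {x : ℝ} (hx : x ∈ Set.Icc (0 : ℝ) 1) :
    |∫ y in (0 : ℝ)..x, p (y : UnitAddCircle)| ≤
      ∫ y in (0 : ℝ)..1, |p (y : UnitAddCircle)| := by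
  refine (intervalIntegral.abs_integral_le_integral_abs hx.1).trans ?_
  refine intervalIntegral.integral_mono_interval le_rfl hx.1 hx.2 ?_
    ((continuous_loop p).abs.intervalIntegrable _ _)
  exact Filter.Eventually.of_forall fun y => abs_nonneg _

theorem integral_exp_primitive_le (p : C(UnitAddCircle, ℝ)) (c : ℝ) (hc : |c| ≤ 2) :
    ∫ x in (0 : ℝ)..1, Real.exp (c * ∫ y in (0 : ℝ)..x, p (y : UnitAddCircle)) ≤
      Real.exp (2 * ∫ y in (0 : ℝ)..1, |p (y : UnitAddCircle)|) := by
  have hc1 : Continuous fun x : ℝ => ∫ y in (0 : ℝ)..x, p (y : UnitAddCircle) :=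
    intervalIntegral.continuous_primitive
      (fun a b => (continuous_loop p).intervalIntegrable a b) 0
  calc _ ≤ ∫ x in (0 : ℝ)..1, Real.exp (2 * ∫ y in (0 : ℝ)..1, |p (y : UnitAddCircle)|) := by
        refine intervalIntegral.integral_mono_on zero_le_one
          ((Real.continuous_exp.comp (hc1.const_mul c)).intervalIntegrable _ _) (by simp) ?_
        intro x hx
        rw [Real.exp_le_exp]
        refine (le_abs_self _).trans ?_
        rw [abs_mul]
        exact mul_le_mul hc (abs_integral_loop_le p hx) (abs_nonneg _) zero_le_two
    _ = _ := by simp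

theorem hillA_le (p : MeanZeroLoop) :
    hillA p ≤ Real.exp (4 * ∫ y in (0 : ℝ)..1, |p.1 (y : UnitAddCircle)|) := by
  unfold hillA
  calc _ ≤ Real.exp (2 * ∫ y in (0 : ℝ)..1, |p.1 (y : UnitAddCircle)|) *
        Real.exp (2 * ∫ y in (0 : ℝ)..1, |p.1 (y : UnitAddCircle)|) := by
        refine mul_le_mul (integral_exp_primitive_le p.1 2 (by norm_num))
          (integral_exp_primitive_le p.1 (-2) (by norm_num)) ?_ (Real.exp_pos _).le
        exact intervalIntegral.integral_nonneg zero_le_one fun x _ => (Real.exp_pos _).le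
    _ = _ := by rw [← Real.exp_add]; ring_nf

/-- A is at most exp(4∫|p|), and 4|y| ≤ 4 + y² is controlled by μ, 1/(2ε) and the fraction ε of the
quartic potential by completing a square. Jensen's inequality over the shifts then acts on the
remaining fraction 1 - ε. -/
theorem exp_mul_hillA_le {ε : ℝ} (hε : 0 < ε) (μ : ℝ) {n : ℕ} (hn : 0 < n) (p : MeanZeroLoop) :
    Real.exp (-(1 / 2) * ∫ x in (0 : ℝ)..1, (μ - p.1 (x : UnitAddCircle) ^ 2) ^ 2) * hillA p ≤
      Real.exp (4 + μ + 1 / (2 * ε)) *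
        ∫ s in (0 : ℝ)..1, Real.exp (-(1 - ε) * gridPotential μ n s p.1) := by
  have hc := continuous_loop p.1
  have hc2 : Continuous fun x : ℝ => (μ - p.1 (x : UnitAddCircle) ^ 2) ^ 2 := by fun_prop
  have h1 : 4 * ∫ y in (0 : ℝ)..1, |p.1 (y : UnitAddCircle)| ≤
      4 + μ + 1 / (2 * ε) + ε / 2 * ∫ x in (0 : ℝ)..1, (μ - p.1 (x : UnitAddCircle) ^ 2) ^ 2 := by
    have : ∫ x in (0 : ℝ)..1, (4 + μ + 1 / (2 * ε) +
          ε / 2 * (μ - p.1 (x : UnitAddCircle) ^ 2) ^ 2) =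
        4 + μ + 1 / (2 * ε) + ε / 2 * ∫ x in (0 : ℝ)..1, (μ - p.1 (x : UnitAddCircle) ^ 2) ^ 2 := by
      rw [intervalIntegral.integral_add (by simp) ((hc2.const_mul _).intervalIntegrable _ _),
        intervalIntegral.integral_const_mul]
      simp
    rw [← this, ← intervalIntegral.integral_const_mul]
    refine intervalIntegral.integral_mono_on zero_le_one
      ((hc.abs.const_mul _).intervalIntegrable _ _)
      ((continuous_const.add (hc2.const_mul _)).intervalIntegrable _ _) fun x _ => ?_
    generalize p.1 (x : UnitAddCircle) = y
    have h2 : 4 * |y| ≤ 4 + y ^ 2 := by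
      rw [← sq_abs]
      nlinarith [sq_nonneg (|y| - 2)]
    have h3 : 1 / (2 * ε) + ε / 2 * (μ - y ^ 2) ^ 2 + (μ - y ^ 2) =
        (ε * (μ - y ^ 2) + 1) ^ 2 / (2 * ε) := by
      field_simp
      ring
    have h4 : 0 ≤ (ε * (μ - y ^ 2) + 1) ^ 2 / (2 * ε) := by positivity
    linarith
  calc _ ≤ Real.exp (-(1 / 2) * ∫ x in (0 : ℝ)..1, (μ - p.1 (x : UnitAddCircle) ^ 2) ^ 2) *
        Real.exp (4 * ∫ y in (0 : ℝ)..1, |p.1 (y : UnitAddCircle)|) := by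
        gcongr
        exact hillA_le p
    _ ≤ Real.exp (4 + μ + 1 / (2 * ε)) *
        Real.exp (∫ s in (0 : ℝ)..1, -(1 - ε) * gridPotential μ n s p.1) := by
        rw [← Real.exp_add, ← Real.exp_add, Real.exp_le_exp, intervalIntegral.integral_const_mul,
          ← integral_eq_integral_gridPotential μ hn]
        linarith
    _ ≤ _ := by
        gcongr
        exact exp_integral_le
          ((continuous_along_shift (continuous_gridPotential μ n) p.1).const_mul _)

/-! ### Action bound on the grid -/

/-- Lower bound for the discretised action of a loop with small grid mean. -/
theorem min_le_gridEnergy_add_gridPotential {n : ℕ} (hn : 0 < n) {ε r : ℝ} (hε : 0 < ε)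
    (hε1 : ε ≤ 1 / 2) (hr : 0 < r) (hnr : 2 / ε * r ≤ n) (s : ℝ) (p : C(UnitAddCircle, ℝ))
    (hm : |gridMean n s p| ≤ r / 4) :
    min ((1 - ε) * (8 / 3 - 4 * ε ^ 2) * r ^ 3) (ε ^ 2 / 16 * r ^ 4) ≤
      gridEnergy n s p + gridPotential (r ^ 2) n s p := by
  have hn' : (0 : ℝ) < n := by exact_mod_cast hn
  have hκ : 2 / ε ≤ n / r := by rwa [le_div_iff₀ hr]
  -- Dividing by r moves the wells to ±1; the action becomes r³ times the lattice energy with κ =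
  -- n/r.
  have h := min_le_lattice_energy hε hε1 hκ (fun i => gridValue n s p i / r)
    (by rw [gridValue_period hn]) (by
      rw [← Finset.sum_div, abs_div, abs_of_pos hr, div_le_iff₀ hr]
      unfold gridMean at hm
      rw [abs_div, abs_of_pos hn', div_le_iff₀ hn'] at hm
      linarith)
  have h2 := mul_le_mul_of_nonneg_right h (pow_pos hr 3).le
  rw [min_mul_of_nonneg _ _ (pow_pos hr 3).le] at h2
  have e1 : (n : ℝ) * ε ^ 2 / (16 * (n / r)) * r ^ 3 = ε ^ 2 / 16 * r ^ 4 := by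
    field_simp
  rw [e1] at h2
  refine h2.trans_eq ?_
  unfold gridEnergy gridPotential
  rw [add_mul, Finset.mul_sum, Finset.mul_sum, Finset.mul_sum, Finset.sum_mul, Finset.sum_mul,
    Finset.sum_div]
  congr 1 <;> refine Finset.sum_congr rfl fun i _ => ?_ <;> field_simp

/-- Small grid mean: trade the potential for the energy through the action bound. Large grid mean:
bound the left side by 1 and apply Chernoff's inequality on both tails. -/
theorem exp_neg_gridPotential_le {n : ℕ} (hn : 0 < n) {ε r : ℝ} (hε : 0 < ε)
    (hε1 : ε ≤ 1 / 2) (hr : 0 < r) (hnr : 2 / ε * r ≤ n) {l : ℝ} (hl : 0 ≤ l) (s : ℝ)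
    (p : C(UnitAddCircle, ℝ)) :
    Real.exp (-(1 - ε) * gridPotential (r ^ 2) n s p) ≤
      Real.exp (-(1 - ε) * min ((1 - ε) * (8 / 3 - 4 * ε ^ 2) * r ^ 3) (ε ^ 2 / 16 * r ^ 4)) *
          Real.exp ((1 - ε) * gridEnergy n s p) +
        Real.exp (-(l * (r / 4))) *
          (Real.exp (l * gridMean n s p) + Real.exp (-l * gridMean n s p)) := by
  by_cases hm : |gridMean n s p| ≤ r / 4
  · have h := min_le_gridEnergy_add_gridPotential hn hε hε1 hr hnr s p hm
    have h1 : Real.exp (-(1 - ε) * gridPotential (r ^ 2) n s p) ≤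
      Real.exp (-(1 - ε) * min ((1 - ε) * (8 / 3 - 4 * ε ^ 2) * r ^ 3) (ε ^ 2 / 16 * r ^ 4)) *
          Real.exp ((1 - ε) * gridEnergy n s p) := by
      rw [← Real.exp_add, Real.exp_le_exp]
      nlinarith
    refine h1.trans (le_add_of_nonneg_right (by positivity))
  · push Not at hm
    have h0 : 0 ≤ gridPotential (r ^ 2) n s p := by unfold gridPotential; positivity
    have h1 : Real.exp (-(1 - ε) * gridPotential (r ^ 2) n s p) ≤ 1 := by
      rw [Real.exp_le_one_iff]
      nlinarith
    have h2 : 1 ≤ Real.exp (-(l * (r / 4))) * Real.exp (l * |gridMean n s p|) := by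
      rw [← Real.exp_add, Real.one_le_exp_iff]
      nlinarith
    have h3 : Real.exp (l * |gridMean n s p|) ≤
        Real.exp (l * gridMean n s p) + Real.exp (-l * gridMean n s p) := by
      rcases abs_cases (gridMean n s p) with ⟨h, -⟩ | ⟨h, -⟩
      · rw [h]
        exact le_add_of_nonneg_right (Real.exp_pos _).le
      · rw [h, mul_neg, neg_mul]
        exact le_add_of_nonneg_left (Real.exp_pos _).le
    calc _ ≤ _ := h1.trans h2
      _ ≤ Real.exp (-(l * (r / 4))) *
          (Real.exp (l * gridMean n s p) + Real.exp (-l * gridMean n s p)) := by gcongr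
      _ ≤ _ := le_add_of_nonneg_left (by positivity)

/-! ### Gaussian exponential moments -/

/-- Exponential moment of a centred Gaussian variable. -/
theorem HasGaussianLaw.lintegral_exp_eq {Ω : Type*} [MeasurableSpace Ω] {P : Measure Ω}
    {X : Ω → ℝ} (hX : HasGaussianLaw X P) (h0 : ∫ ω, X ω ∂P = 0) :
    ∫⁻ ω, ENNReal.ofReal (Real.exp (X ω)) ∂P = ENNReal.ofReal (Real.exp (Var[X; P] / 2)) := by
  have h := mgf_gaussianReal hX.map_eq_gaussianReal 1
  simp only [mgf, one_mul, h0, zero_add, one_pow, mul_one,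
    Real.coe_toNNReal _ (variance_nonneg _ _)] at h
  -- A nonintegrable function has Bochner integral 0, so a positive value proves integrability.
  have hi : Integrable (fun ω => Real.exp (X ω)) P := by
    by_contra hn
    rw [integral_undef hn] at h
    exact (Real.exp_pos _).ne h
  rw [← h, ofReal_integral_eq_lintegral_ofReal hi
    (Filter.Eventually.of_forall fun _ => (Real.exp_pos _).le)]

theorem lintegral_pi_prod_eq {ι : Type*} [Fintype ι] {γ : Measure ℝ} [SigmaFinite γ]
    {f : ι → ℝ → ℝ} (h0 : ∀ i x, 0 ≤ f i x) (hf : ∀ i, Integrable (f i) γ) :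
    ∫⁻ g : ι → ℝ, ENNReal.ofReal (∏ i, f i (g i)) ∂(Measure.pi fun _ => γ) =
      ENNReal.ofReal (∏ i, ∫ x, f i x ∂γ) := by
  rw [← integral_fintype_prod_eq_prod, ofReal_integral_eq_lintegral_ofReal
    (Integrable.fintype_prod hf)
    (Filter.Eventually.of_forall fun g => Finset.prod_nonneg fun i _ => h0 i _)]

theorem integral_exp_mul_standardGaussian (c : ℝ) :
    ∫ x, Real.exp (c * x) ∂(gaussianReal 0 1) = Real.exp (c ^ 2 / 2) := by
  have h := congrFun (mgf_id_gaussianReal (μ := 0) (v := 1)) c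
  simpa [mgf] using h

theorem integral_exp_sq_standardGaussian {θ : ℝ} (hθ : θ < 1) :
    ∫ x, Real.exp (θ / 2 * x ^ 2) ∂(gaussianReal 0 1) = (√(1 - θ))⁻¹ := by
  rw [integral_gaussianReal_eq_integral_smul one_ne_zero]
  have h : ∀ x : ℝ, gaussianPDFReal 0 1 x • Real.exp (θ / 2 * x ^ 2) =
      (√(2 * Real.pi))⁻¹ * Real.exp (-((1 - θ) / 2) * x ^ 2) := by
    intro x
    rw [gaussianPDFReal, smul_eq_mul, mul_assoc, ← Real.exp_add]
    simp only [NNReal.coe_one, mul_one, sub_zero]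
    ring_nf
  simp only [h]
  have hpi := Real.pi_pos
  have h1 : 0 < 1 - θ := by linarith
  rw [integral_const_mul, integral_gaussian, ← Real.sqrt_inv, ← Real.sqrt_inv,
    ← Real.sqrt_mul (by positivity)]
  congr 1
  field_simp

/-- A Gaussian exponential moment bound for a quadratic form from exponential moment bounds for
linear forms, by linearisation of the square. -/
theorem lintegral_exp_sum_sq_le {Ω ι : Type*} [Fintype ι] [MeasurableSpace Ω] {P : Measure Ω}
    [SFinite P] {θ : ℝ} (hθ : θ < 1) {X : ι → Ω → ℝ} (hX : ∀ i, Measurable (X i))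
    (h : ∀ g : ι → ℝ, ∫⁻ ω, ENNReal.ofReal (Real.exp (∑ i, g i * X i ω)) ∂P ≤
      ENNReal.ofReal (Real.exp (θ / 2 * ∑ i, g i ^ 2))) :
    ∫⁻ ω, ENNReal.ofReal (Real.exp (1 / 2 * ∑ i, X i ω ^ 2)) ∂P ≤
      ENNReal.ofReal ((√(1 - θ))⁻¹ ^ Fintype.card ι) := by
  have hint : ∀ {f : ℝ → ℝ}, ∫ x, f x ∂(gaussianReal 0 1) ≠ 0 → Integrable f (gaussianReal 0 1) :=
    fun hf => by_contra fun hn => hf (integral_undef hn)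
  -- exp(x²/2) is the expectation of exp(gx) for a standard Gaussian g; after Tonelli only linear
  -- forms in `X` remain.
  have key : ∀ ω, ENNReal.ofReal (Real.exp (1 / 2 * ∑ i, X i ω ^ 2)) =
      ∫⁻ g : ι → ℝ, ENNReal.ofReal (Real.exp (∑ i, g i * X i ω))
        ∂(Measure.pi fun _ => gaussianReal 0 1) := by
    intro ω
    have := lintegral_pi_prod_eq (γ := gaussianReal 0 1) (f := fun i x => Real.exp (X i ω * x))
      (fun i x => (Real.exp_pos _).le) fun i => hint <| by
        rw [integral_exp_mul_standardGaussian]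
        exact (Real.exp_pos _).ne'
    simp only [integral_exp_mul_standardGaussian, ← Real.exp_sum, ← Finset.sum_div] at this
    simp only [mul_comm _ (X _ ω), this]
    congr 2
    ring
  simp only [key]
  rw [lintegral_lintegral_swap]
  · refine (lintegral_mono h).trans_eq ?_
    have := lintegral_pi_prod_eq (ι := ι) (γ := gaussianReal 0 1)
      (f := fun _ x => Real.exp (θ / 2 * x ^ 2))
      (fun i x => (Real.exp_pos _).le) fun i => hint <| by
        rw [integral_exp_sq_standardGaussian hθ]
        have : 0 < 1 - θ := by linarith
        positivity
    simp only [integral_exp_sq_standardGaussian hθ, ← Real.exp_sum, ← Finset.mul_sum,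
      Finset.prod_const, Finset.card_univ] at this
    exact this
  · refine Measurable.aemeasurable ?_
    refine (Real.measurable_exp.comp ?_).ennreal_ofReal
    refine Finset.measurable_sum _ fun i _ => ?_
    exact ((measurable_pi_apply i).comp measurable_snd).mul ((hX i).comp measurable_fst)

/-! ### Increments of the Brownian bridge -/

section Bridge

variable {ν : Measure C(UnitAddCircle, ℝ)}

theorem IsBrownianBridgeLaw.isProbabilityMeasure (hν : IsBrownianBridgeLaw ν) :
    IsProbabilityMeasure ν := hν.gaussian.isProbabilityMeasure

theorem IsBrownianBridgeLaw.memLp (hν : IsBrownianBridgeLaw ν) {t : ℝ}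
    (ht : t ∈ Set.Icc (0 : ℝ) 1) :
    MemLp (fun b : C(UnitAddCircle, ℝ) => b (t : UnitAddCircle)) 2 ν :=
  (hν.gaussian.hasGaussianLaw_eval ⟨t, ht⟩).memLp_two

theorem IsBrownianBridgeLaw.integrable (hν : IsBrownianBridgeLaw ν) {t : ℝ}
    (ht : t ∈ Set.Icc (0 : ℝ) 1) :
    Integrable (fun b : C(UnitAddCircle, ℝ) => b (t : UnitAddCircle)) ν :=
  (hν.gaussian.hasGaussianLaw_eval ⟨t, ht⟩).integrable

/-- Increments of the bridge form a Gaussian process. -/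
theorem IsBrownianBridgeLaw.isGaussianProcess_sub (hν : IsBrownianBridgeLaw ν) {ι : Type*}
    (u v : ι → Set.Icc (0 : ℝ) 1) :
    IsGaussianProcess (fun i (b : C(UnitAddCircle, ℝ)) =>
      b ((u i : ℝ) : UnitAddCircle) - b ((v i : ℝ) : UnitAddCircle)) ν := by
  classical
  refine hν.gaussian.of_isGaussianProcess fun i => ⟨{u i, v i}, ?_, ?_⟩
  · exact ContinuousLinearMap.proj (R := ℝ) (φ := fun _ => ℝ) ⟨u i, by simp⟩ -
      ContinuousLinearMap.proj (R := ℝ) (φ := fun _ => ℝ) ⟨v i, by simp⟩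
  · intro b
    simp

theorem IsBrownianBridgeLaw.integral_sub_eq_zero (hν : IsBrownianBridgeLaw ν) {s t : ℝ}
    (hs : s ∈ Set.Icc (0 : ℝ) 1) (ht : t ∈ Set.Icc (0 : ℝ) 1) :
    ∫ b : C(UnitAddCircle, ℝ), (b (s : UnitAddCircle) - b (t : UnitAddCircle)) ∂ν = 0 := by
  rw [integral_sub (hν.integrable hs) (hν.integrable ht), hν.mean_eq_zero s hs,
    hν.mean_eq_zero t ht, sub_zero]

theorem IsBrownianBridgeLaw.covariance_sub_sub_eq (hν : IsBrownianBridgeLaw ν) {s t u v : ℝ}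
    (hs : s ∈ Set.Icc (0 : ℝ) 1) (ht : t ∈ Set.Icc (0 : ℝ) 1)
    (hu : u ∈ Set.Icc (0 : ℝ) 1) (hv : v ∈ Set.Icc (0 : ℝ) 1) :
    cov[fun b : C(UnitAddCircle, ℝ) => b (t : UnitAddCircle) - b (s : UnitAddCircle),
      fun b : C(UnitAddCircle, ℝ) => b (v : UnitAddCircle) - b (u : UnitAddCircle); ν] =
      min t v - min t u - min s v + min s u - (t - s) * (v - u) := by
  have := hν.isProbabilityMeasure
  rw [covariance_fun_sub_fun_sub (hν.memLp ht) (hν.memLp hs) (hν.memLp hv) (hν.memLp hu),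
    hν.covariance_eq t ht v hv, hν.covariance_eq t ht u hu, hν.covariance_eq s hs v hv,
    hν.covariance_eq s hs u hu]
  ring

/-- Exponential moment bound for an increment of the bridge. -/
theorem IsBrownianBridgeLaw.lintegral_exp_sub_le (hν : IsBrownianBridgeLaw ν) {s t : ℝ}
    (hs : s ∈ Set.Icc (0 : ℝ) 1) (ht : t ∈ Set.Icc (0 : ℝ) 1) (l : ℝ) :
    ∫⁻ b : C(UnitAddCircle, ℝ), ENNReal.ofReal
      (Real.exp (l * (b (t : UnitAddCircle) - b (s : UnitAddCircle)))) ∂ν ≤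
      ENNReal.ofReal (Real.exp (l ^ 2 * |t - s| / 2)) := by
  have hG := ((hν.isGaussianProcess_sub (fun _ : Unit => ⟨t, ht⟩)
    (fun _ => ⟨s, hs⟩)).hasGaussianLaw_eval ()).fun_smul l
  simp only [smul_eq_mul] at hG
  rw [HasGaussianLaw.lintegral_exp_eq hG (by
    rw [integral_const_mul, hν.integral_sub_eq_zero ht hs, mul_zero])]
  refine ENNReal.ofReal_le_ofReal (Real.exp_le_exp.2 ?_)
  rw [variance_const_mul, ← covariance_self (by
    exact ((hν.memLp ht).sub (hν.memLp hs)).aestronglyMeasurable.aemeasurable),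
    hν.covariance_sub_sub_eq hs ht hs ht]
  have : min t t - min t s - min s t + min s s - (t - s) * (t - s) ≤ |t - s| := by
    rw [min_self, min_self, min_comm s t]
    rcases le_total s t with h | h
    · rw [min_eq_right h, abs_of_nonneg (by linarith)]
      nlinarith [sq_nonneg (t - s)]
    · rw [min_eq_left h, abs_of_nonpos (by linarith)]
      nlinarith [sq_nonneg (t - s)]
  have := mul_le_mul_of_nonneg_left this (sq_nonneg l)
  linarith

/-- The points of the translated grid, the last of which is identified with the first. -/
noncomputable def gridPoint (n : ℕ) (s : ℝ) (i : ℕ) : ℝ := if i < n then (i + s) / n else s / n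

theorem gridPoint_mem {n : ℕ} (hn : 0 < n) {s : ℝ} (hs : s ∈ Set.Icc (0 : ℝ) 1) (i : ℕ) :
    gridPoint n s i ∈ Set.Icc (0 : ℝ) 1 := by
  have hn' : (1 : ℝ) ≤ n := by exact_mod_cast hn
  unfold gridPoint
  split_ifs with h
  · have h' : (i + 1 : ℝ) ≤ n := by exact_mod_cast h
    exact ⟨div_nonneg (add_nonneg i.cast_nonneg hs.1) n.cast_nonneg,
      (div_le_one (by linarith)).2 (by linarith [hs.2])⟩
  · exact ⟨div_nonneg hs.1 n.cast_nonneg, (div_le_one (by linarith)).2 (by linarith [hs.2])⟩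

/-- The law prescribes covariances only for times in [0, 1], so the endpoint (n + s)/n is wrapped to
s/n. -/
theorem gridValue_eq_apply_gridPoint {n : ℕ} (hn : 0 < n) (s : ℝ) (p : C(UnitAddCircle, ℝ))
    {i : ℕ} (hi : i ≤ n) : gridValue n s p i = p (gridPoint n s i : UnitAddCircle) := by
  rcases hi.lt_or_eq with h | rfl
  · simp [gridPoint, gridValue, h]
  · rw [gridValue_period hn]
    simp [gridPoint, gridValue]

theorem IsBrownianBridgeLaw.covariance_gridIncrement_of_lt (hν : IsBrownianBridgeLaw ν) {n : ℕ}
    (hn : 0 < n) {s : ℝ} (hs : s ∈ Set.Icc (0 : ℝ) 1) {i j : ℕ} (hij : i < j) (hj : j < n) :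
    cov[fun b : C(UnitAddCircle, ℝ) => b (gridPoint n s (i + 1) : UnitAddCircle) -
        b (gridPoint n s i : UnitAddCircle),
      fun b : C(UnitAddCircle, ℝ) => b (gridPoint n s (j + 1) : UnitAddCircle) -
        b (gridPoint n s j : UnitAddCircle); ν] = -(1 / n : ℝ) ^ 2 := by
  rw [hν.covariance_sub_sub_eq (gridPoint_mem hn hs _) (gridPoint_mem hn hs _)
    (gridPoint_mem hn hs _) (gridPoint_mem hn hs _)]
  have hn' : (0 : ℝ) < n := by exact_mod_cast hn
  have hi0 : (0 : ℝ) ≤ i := i.cast_nonneg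
  have hij' : (i + 1 : ℝ) ≤ j := by exact_mod_cast hij
  have e1 : gridPoint n s (i + 1) = (i + 1 + s) / n := by
    simp [gridPoint, show i + 1 < n by omega]
  have e2 : gridPoint n s i = (i + s) / n := by simp [gridPoint, show i < n by omega]
  have e3 : gridPoint n s j = (j + s) / n := by simp [gridPoint, hj]
  have l1 : (i + 1 + s) / n ≤ (j + s) / n := by gcongr
  have l2 : (i + s) / n ≤ (j + s) / n := by gcongr
  rw [e1, e2, e3, min_eq_left l1, min_eq_left l2]
  -- The increment ending at the wrapped point needs its own computation, but has the same
  -- covariance.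
  rcases Nat.lt_or_ge (j + 1) n with h | h
  · have e4 : gridPoint n s (j + 1) = (j + 1 + s) / n := by simp [gridPoint, h]
    have l3 : (i + 1 + s) / n ≤ (j + 1 + s) / n := by gcongr
    have l4 : (i + s) / n ≤ (j + 1 + s) / n := by gcongr; linarith
    rw [e4, min_eq_left l3, min_eq_left l4]
    ring
  · have e4 : gridPoint n s (j + 1) = s / n := by simp [gridPoint, show ¬ j + 1 < n by omega]
    have l3 : s / n ≤ (i + 1 + s) / n := div_le_div_of_nonneg_right (by linarith) hn'.le
    have l4 : s / n ≤ (i + s) / n := div_le_div_of_nonneg_right (by linarith) hn'.le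
    have hnj : (n : ℝ) = j + 1 := by exact_mod_cast (show n = j + 1 by omega)
    rw [e4, min_eq_right l3, min_eq_right l4]
    field_simp
    rw [hnj]
    ring

theorem IsBrownianBridgeLaw.covariance_gridIncrement_self (hν : IsBrownianBridgeLaw ν) {n : ℕ}
    (hn : 0 < n) {s : ℝ} (hs : s ∈ Set.Icc (0 : ℝ) 1) {i : ℕ} (hi : i < n) :
    cov[fun b : C(UnitAddCircle, ℝ) => b (gridPoint n s (i + 1) : UnitAddCircle) -
        b (gridPoint n s i : UnitAddCircle),
      fun b : C(UnitAddCircle, ℝ) => b (gridPoint n s (i + 1) : UnitAddCircle) -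
        b (gridPoint n s i : UnitAddCircle); ν] = 1 / n - (1 / n : ℝ) ^ 2 := by
  rw [hν.covariance_sub_sub_eq (gridPoint_mem hn hs _) (gridPoint_mem hn hs _)
    (gridPoint_mem hn hs _) (gridPoint_mem hn hs _), min_self, min_self]
  have hn' : (0 : ℝ) < n := by exact_mod_cast hn
  have hi0 : (0 : ℝ) ≤ i := i.cast_nonneg
  have e2 : gridPoint n s i = (i + s) / n := by simp [gridPoint, hi]
  rcases Nat.lt_or_ge (i + 1) n with h | h
  · have e1 : gridPoint n s (i + 1) = (i + 1 + s) / n := by simp [gridPoint, h]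
    have l1 : (i + s) / n ≤ (i + 1 + s) / n := div_le_div_of_nonneg_right (by linarith) hn'.le
    rw [e1, e2, min_eq_right l1, min_eq_left l1]
    ring
  · have e1 : gridPoint n s (i + 1) = s / n := by simp [gridPoint, show ¬ i + 1 < n by omega]
    have l1 : s / n ≤ (i + s) / n := div_le_div_of_nonneg_right (by linarith) hn'.le
    have hni : (n : ℝ) = i + 1 := by exact_mod_cast (show n = i + 1 by omega)
    rw [e1, e2, min_eq_right l1, min_eq_left l1]
    field_simp
    rw [hni]
    ring

/-- The cyclic increments behave like independent centred Gaussians of variance 1/n conditioned to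
sum to zero. -/
theorem IsBrownianBridgeLaw.covariance_gridIncrement (hν : IsBrownianBridgeLaw ν) {n : ℕ}
    (hn : 0 < n) {s : ℝ} (hs : s ∈ Set.Icc (0 : ℝ) 1) {i j : ℕ} (hi : i < n) (hj : j < n) :
    cov[fun b : C(UnitAddCircle, ℝ) => b (gridPoint n s (i + 1) : UnitAddCircle) -
        b (gridPoint n s i : UnitAddCircle),
      fun b : C(UnitAddCircle, ℝ) => b (gridPoint n s (j + 1) : UnitAddCircle) -
        b (gridPoint n s j : UnitAddCircle); ν] =
      (if i = j then (1 / n : ℝ) else 0) - (1 / n : ℝ) ^ 2 := by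
  rcases lt_trichotomy i j with h | rfl | h
  · rw [hν.covariance_gridIncrement_of_lt hn hs h hj, if_neg h.ne, zero_sub]
  · rw [hν.covariance_gridIncrement_self hn hs hi, if_pos rfl]
  · rw [covariance_comm, hν.covariance_gridIncrement_of_lt hn hs h hi, if_neg h.ne', zero_sub]

/-- Exponential moments of linear forms in the cyclic increments of the bridge. -/
theorem IsBrownianBridgeLaw.lintegral_exp_gridIncrement_le (hν : IsBrownianBridgeLaw ν) {n : ℕ}
    (hn : 0 < n) {s : ℝ} (hs : s ∈ Set.Icc (0 : ℝ) 1) (g : Fin n → ℝ) :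
    ∫⁻ b : C(UnitAddCircle, ℝ), ENNReal.ofReal (Real.exp (∑ i, g i *
      (b (gridPoint n s (i + 1) : UnitAddCircle) - b (gridPoint n s i : UnitAddCircle)))) ∂ν ≤
      ENNReal.ofReal (Real.exp (1 / (2 * n) * ∑ i, g i ^ 2)) := by
  have hprob := hν.isProbabilityMeasure
  have hL : ∀ i : Fin n, MemLp (fun b : C(UnitAddCircle, ℝ) =>
      b (gridPoint n s (i + 1) : UnitAddCircle) - b (gridPoint n s i : UnitAddCircle)) 2 ν :=
    fun i => (hν.memLp (gridPoint_mem hn hs _)).sub (hν.memLp (gridPoint_mem hn hs _))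
  have hG := ((hν.isGaussianProcess_sub
    (fun i : Fin n => ⟨gridPoint n s (i + 1), gridPoint_mem hn hs _⟩)
    (fun i => ⟨gridPoint n s i, gridPoint_mem hn hs _⟩)).smul g).hasGaussianLaw_fun_sum
    (I := Finset.univ)
  simp only [smul_eq_mul] at hG
  rw [HasGaussianLaw.lintegral_exp_eq hG]
  · refine ENNReal.ofReal_le_ofReal (Real.exp_le_exp.2 ?_)
    rw [← covariance_self hG.aemeasurable, covariance_fun_sum_fun_sum
      (fun i => (hL i).const_mul (g i)) (fun i => (hL i).const_mul (g i))]
    simp only [covariance_const_mul_left, covariance_const_mul_right,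
      hν.covariance_gridIncrement hn hs (Fin.is_lt _) (Fin.is_lt _), Fin.val_inj]
    -- The conditioning contributes a negative square, which is dropped.
    have h1 : ∑ i, ∑ j, g j * (g i * ((if i = j then (1 / n : ℝ) else 0) - (1 / n : ℝ) ^ 2)) =
        1 / n * ∑ i, g i ^ 2 - (1 / n * ∑ i, g i) ^ 2 := by
      simp only [mul_sub, Finset.sum_sub_distrib, mul_ite, mul_zero, Finset.sum_ite_eq,
        Finset.mem_univ, if_true]
      congr 1
      · rw [Finset.mul_sum]
        exact Finset.sum_congr rfl fun i _ => by ring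
      · rw [mul_pow, sq (∑ i, g i), Finset.sum_mul_sum, Finset.mul_sum]
        refine Finset.sum_congr rfl fun i _ => ?_
        rw [Finset.mul_sum]
        exact Finset.sum_congr rfl fun j _ => by ring
    have h2 : (1 / (2 * n) : ℝ) = 1 / n / 2 := by ring
    rw [h2]
    nlinarith [h1, sq_nonneg (1 / n * ∑ i, g i)]
  · rw [integral_finsetSum _ fun i _ => ((hL i).integrable one_le_two).const_mul (g i)]
    refine Finset.sum_eq_zero fun i _ => ?_
    rw [integral_const_mul, hν.integral_sub_eq_zero (gridPoint_mem hn hs _)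
      (gridPoint_mem hn hs _), mul_zero]

/-- Exponential moments of the discretised Dirichlet energy of the bridge. -/
theorem IsBrownianBridgeLaw.lintegral_exp_gridEnergy_le (hν : IsBrownianBridgeLaw ν) {n : ℕ}
    (hn : 0 < n) {s : ℝ} (hs : s ∈ Set.Icc (0 : ℝ) 1) {θ : ℝ} (hθ0 : 0 ≤ θ) (hθ : θ < 1) :
    ∫⁻ b, ENNReal.ofReal (Real.exp (θ * gridEnergy n s b)) ∂ν ≤
      ENNReal.ofReal ((√(1 - θ))⁻¹ ^ n) := by
  have hprob := hν.isProbabilityMeasure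
  have hn' : (0 : ℝ) < n := by exact_mod_cast hn
  have hmeas : ∀ i : Fin n, Measurable fun b : C(UnitAddCircle, ℝ) => √(θ * n) *
      (b (gridPoint n s (i + 1) : UnitAddCircle) - b (gridPoint n s i : UnitAddCircle)) :=
    fun i => Continuous.measurable (by fun_prop)
  have h := lintegral_exp_sum_sq_le (P := ν) hθ hmeas fun g => by
    have := hν.lintegral_exp_gridIncrement_le hn hs fun i => g i * √(θ * n)
    simp only [mul_pow, Real.sq_sqrt (mul_nonneg hθ0 hn'.le), ← Finset.sum_mul, mul_assoc] at this
    refine this.trans_eq ?_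
    congr 2
    field_simp
  rw [Fintype.card_fin] at h
  refine le_trans (lintegral_mono fun b => ?_) h
  refine ENNReal.ofReal_le_ofReal (Real.exp_le_exp.2 (le_of_eq ?_))
  unfold gridEnergy
  simp only [mul_pow, Real.sq_sqrt (mul_nonneg hθ0 hn'.le), ← Finset.mul_sum]
  rw [Finset.sum_range, Finset.sum_congr rfl fun (i : Fin n) _ => by
    rw [gridValue_eq_apply_gridPoint hn s b (i.is_lt : (i : ℕ) + 1 ≤ n),
      gridValue_eq_apply_gridPoint hn s b i.is_lt.le]]
  ring

end Bridge

/-! ### Centring and the grid mean -/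

theorem continuous_coe_centerLoop : Continuous fun b => (centerLoop b).1 :=
  continuous_id.sub (ContinuousMap.continuous_const'.comp continuous_loopMean)

theorem gridValue_centerLoop (n : ℕ) (s : ℝ) (b : C(UnitAddCircle, ℝ)) (i : ℕ) :
    gridValue n s (centerLoop b).1 i = gridValue n s b i - loopMean b := rfl

theorem gridEnergy_centerLoop (n : ℕ) (s : ℝ) (b : C(UnitAddCircle, ℝ)) :
    gridEnergy n s (centerLoop b).1 = gridEnergy n s b := by
  simp only [gridEnergy, gridValue_centerLoop, sub_sub_sub_cancel_right]

/-- The true mean is the average of the grid means over all shifts, so what is left compares two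
grids whose points differ by at most 1/n. -/
theorem gridMean_centerLoop {n : ℕ} (hn : 0 < n) (s : ℝ) (b : C(UnitAddCircle, ℝ)) :
    gridMean n s (centerLoop b).1 = ∫ u in (0 : ℝ)..1, (gridMean n s b - gridMean n u b) := by
  have hn' : (n : ℝ) ≠ 0 := by positivity
  rw [intervalIntegral.integral_sub (by simp)
    ((continuous_along_shift (continuous_gridMean n) b).intervalIntegrable _ _),
    ← loopMean_eq_integral_gridMean hn]
  simp only [gridMean, gridValue_centerLoop, Finset.sum_sub_distrib]
  simp [sub_div, hn']

/-- Tonelli's theorem, as an upper bound, for the average over shifts. -/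
theorem lintegral_ofReal_integral_shift_le {ν : Measure C(UnitAddCircle, ℝ)} [SFinite ν]
    {f : ℝ × C(UnitAddCircle, ℝ) → ℝ} (hf : Continuous f) (h0 : ∀ x, 0 ≤ f x) {B : ENNReal}
    (h : ∀ s ∈ Set.Icc (0 : ℝ) 1, ∫⁻ b, ENNReal.ofReal (f (s, b)) ∂ν ≤ B) :
    ∫⁻ b, ENNReal.ofReal (∫ s in (0 : ℝ)..1, f (s, b)) ∂ν ≤ B := by
  have e : ∀ b, ENNReal.ofReal (∫ s in (0 : ℝ)..1, f (s, b)) =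
      ∫⁻ s in Set.Ioc (0 : ℝ) 1, ENNReal.ofReal (f (s, b)) := fun b => by
    rw [intervalIntegral.integral_of_le zero_le_one, ofReal_integral_eq_lintegral_ofReal
      ((continuous_along_shift hf b).intervalIntegrable 0 1).1
      (Filter.Eventually.of_forall fun s => h0 _)]
  simp only [e]
  rw [lintegral_lintegral_swap]
  · calc _ ≤ ∫⁻ s in Set.Ioc (0 : ℝ) 1, B :=
        setLIntegral_mono measurable_const fun s hs => h s ⟨hs.1.le, hs.2⟩
      _ = B := by simp
  · exact (ENNReal.continuous_ofReal.comp (hf.comp continuous_swap)).measurable.aemeasurable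

/-- Exponential moment bound for the discretised mean of the centred bridge. -/
theorem IsBrownianBridgeLaw.lintegral_exp_gridMean_le {ν : Measure C(UnitAddCircle, ℝ)}
    (hν : IsBrownianBridgeLaw ν) {n : ℕ} (hn : 0 < n) {s : ℝ} (hs : s ∈ Set.Icc (0 : ℝ) 1)
    (l : ℝ) :
    ∫⁻ b, ENNReal.ofReal (Real.exp (l * gridMean n s (centerLoop b).1)) ∂ν ≤
      ENNReal.ofReal (Real.exp (l ^ 2 / (2 * n))) := by
  have hprob := hν.isProbabilityMeasure
  have hn' : (0 : ℝ) < n := by exact_mod_cast hn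
  have hval : ∀ i, Continuous fun b : C(UnitAddCircle, ℝ) => gridValue n s b i := fun i =>
    (continuous_gridValue n i).comp (continuous_const.prodMk continuous_id)
  -- Jensen's inequality over both the shift and the grid index reduces to single increments over
  -- times at most 1/n, so their correlations are not needed.
  set f : ℝ × C(UnitAddCircle, ℝ) → ℝ := fun x =>
    ∑ i ∈ Finset.range n, 1 / n * Real.exp (l * (gridValue n s x.2 i - gridValue n x.1 x.2 i))
    with hfdef
  have hf : Continuous f := continuous_finsetSum _ fun i _ => (Real.continuous_exp.comp
    ((((hval i).comp continuous_snd).sub (continuous_gridValue n i)).const_mul l)).const_mul _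
  have hconv : ∀ u b, Real.exp (l * (gridMean n s b - gridMean n u b)) ≤ f (u, b) := by
    intro u b
    have := convexOn_exp.map_sum_le (t := Finset.range n) (w := fun _ => 1 / (n : ℝ))
      (p := fun i => l * (gridValue n s b i - gridValue n u b i))
      (fun _ _ => by positivity) (by simp [hn'.ne']) (fun _ _ => Set.mem_univ _)
    simp only [smul_eq_mul] at this
    refine le_trans (le_of_eq ?_) this
    rw [← Finset.mul_sum, ← Finset.mul_sum, Finset.sum_sub_distrib]
    unfold gridMean
    congr 1
    ring
  have h1 : ∀ b, Real.exp (l * gridMean n s (centerLoop b).1) ≤ ∫ u in (0 : ℝ)..1, f (u, b) := by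
    intro b
    have hc : Continuous fun u => l * (gridMean n s b - gridMean n u b) :=
      (continuous_const.sub (continuous_along_shift (continuous_gridMean n) b)).const_mul l
    rw [gridMean_centerLoop hn, ← intervalIntegral.integral_const_mul]
    refine (exp_integral_le hc).trans ?_
    exact intervalIntegral.integral_mono_on zero_le_one
      ((Real.continuous_exp.comp hc).intervalIntegrable _ _)
      ((continuous_along_shift hf b).intervalIntegrable _ _) fun u _ => hconv u b
  refine (lintegral_mono fun b => ENNReal.ofReal_le_ofReal (h1 b)).trans ?_
  refine lintegral_ofReal_integral_shift_le hf
    (fun x => Finset.sum_nonneg fun i _ => by positivity) fun u hu => ?_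
  have hpos : ∀ b : C(UnitAddCircle, ℝ), ENNReal.ofReal (f (u, b)) = ∑ i ∈ Finset.range n,
      ENNReal.ofReal (1 / n) * ENNReal.ofReal
        (Real.exp (l * (gridValue n s b i - gridValue n u b i))) := fun b => by
    rw [hfdef, ENNReal.ofReal_sum_of_nonneg fun i _ => by positivity]
    exact Finset.sum_congr rfl fun i _ => ENNReal.ofReal_mul (by positivity)
  have hmeas : ∀ i, Measurable fun b : C(UnitAddCircle, ℝ) => ENNReal.ofReal
      (Real.exp (l * (gridValue n s b i - gridValue n u b i))) := fun i =>
    (Continuous.measurable (Real.continuous_exp.comp (((hval i).sub ((continuous_gridValue n i).comp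
      (continuous_const.prodMk continuous_id))).const_mul l))).ennreal_ofReal
  simp only [hpos]
  rw [lintegral_finsetSum _ fun i _ => (hmeas i).const_mul _]
  calc _ ≤ ∑ i ∈ Finset.range n, ENNReal.ofReal (1 / n) *
        ENNReal.ofReal (Real.exp (l ^ 2 / (2 * n))) := by
        refine Finset.sum_le_sum fun i hi => ?_
        rw [lintegral_const_mul _ (hmeas i)]
        gcongr
        have hi' := Finset.mem_range.1 hi
        have hpt : ∀ {v : ℝ}, v ∈ Set.Icc (0 : ℝ) 1 → (i + v) / n ∈ Set.Icc (0 : ℝ) 1 := by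
          intro v hv
          simpa [gridPoint, hi'] using gridPoint_mem hn hv i
        refine (hν.lintegral_exp_sub_le (hpt hu) (hpt hs) l).trans ?_
        refine ENNReal.ofReal_le_ofReal (Real.exp_le_exp.2 ?_)
        have h2 : |(i + s) / n - (i + u) / n| ≤ 1 / n := by
          rw [← sub_div, abs_div, abs_of_pos hn']
          gcongr
          rw [abs_le]
          constructor <;> linarith [hs.1, hs.2, hu.1, hu.2]
        calc l ^ 2 * |(i + s) / n - (i + u) / n| / 2 ≤ l ^ 2 * (1 / n) / 2 := by gcongr
          _ = l ^ 2 / (2 * n) := by ring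
    _ = _ := by
        rw [Finset.sum_const, Finset.card_range, nsmul_eq_mul, ← mul_assoc,
          ← ENNReal.ofReal_natCast, ← ENNReal.ofReal_mul hn'.le]
        simp [hn'.ne']

/-! ### Assembly and asymptotics -/

/-- The nonasymptotic bound obtained from a grid of `n` points. -/
theorem IsBrownianBridgeLaw.hillIntegral_le {ν : Measure C(UnitAddCircle, ℝ)}
    (hν : IsBrownianBridgeLaw ν) {n : ℕ} (hn : 0 < n) {ε r : ℝ} (hε : 0 < ε)
    (hε1 : ε ≤ 1 / 2) (hr : 0 < r) (hnr : 2 / ε * r ≤ n) :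
    hillIntegral (meanZeroCBM ν) (r ^ 2) ≤ ENNReal.ofReal
      (Real.exp (4 + r ^ 2 + 1 / (2 * ε)) *
        (Real.exp (-(1 - ε) * min ((1 - ε) * (8 / 3 - 4 * ε ^ 2) * r ^ 3) (ε ^ 2 / 16 * r ^ 4)) *
          (√ε)⁻¹ ^ n + 2 * Real.exp (-(r ^ 2 * n / 32)))) := by
  have hprob := hν.isProbabilityMeasure
  have hn' : (0 : ℝ) < n := by exact_mod_cast hn
  set M := Real.exp (-(1 - ε) * min ((1 - ε) * (8 / 3 - 4 * ε ^ 2) * r ^ 3) (ε ^ 2 / 16 * r ^ 4))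
  set f : ℝ × C(UnitAddCircle, ℝ) → ℝ := fun x =>
    Real.exp (-(1 - ε) * gridPotential (r ^ 2) n x.1 (centerLoop x.2).1) with hfdef
  have hf : Continuous f := Real.continuous_exp.comp
    (((continuous_gridPotential (r ^ 2) n).comp (continuous_fst.prodMk
      (continuous_coe_centerLoop.comp continuous_snd))).const_mul _)
  have hshift : ∀ s ∈ Set.Icc (0 : ℝ) 1, ∫⁻ b, ENNReal.ofReal (f (s, b)) ∂ν ≤
      ENNReal.ofReal (M * (√ε)⁻¹ ^ n + 2 * Real.exp (-(r ^ 2 * n / 32))) := by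
    intro s hs
    -- The minimiser of the Chernoff exponent -lr/4 + l²/(2n), with value -r²n/32.
    set l : ℝ := r * n / 4 with hl
    have hl0 : 0 ≤ l := by positivity
    have hE := hν.lintegral_exp_gridEnergy_le hn hs (θ := 1 - ε) (by linarith) (by linarith)
    rw [sub_sub_cancel] at hE
    have h1 := hν.lintegral_exp_gridMean_le hn hs l
    have h2 := hν.lintegral_exp_gridMean_le hn hs (-l)
    rw [neg_sq] at h2
    have hcE : Measurable fun b => ENNReal.ofReal (Real.exp ((1 - ε) * gridEnergy n s b)) :=
      (Continuous.measurable (Real.continuous_exp.comp (((continuous_gridEnergy n).comp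
        (continuous_const.prodMk continuous_id)).const_mul _))).ennreal_ofReal
    have hcM : ∀ a : ℝ, Measurable fun b =>
        ENNReal.ofReal (Real.exp (a * gridMean n s (centerLoop b).1)) := fun a =>
      (Continuous.measurable (Real.continuous_exp.comp (((continuous_gridMean n).comp
        (continuous_const.prodMk continuous_coe_centerLoop)).const_mul _))).ennreal_ofReal
    calc ∫⁻ b, ENNReal.ofReal (f (s, b)) ∂ν ≤
        ∫⁻ b, (ENNReal.ofReal M * ENNReal.ofReal (Real.exp ((1 - ε) * gridEnergy n s b)) +
          ENNReal.ofReal (Real.exp (-(l * (r / 4)))) *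
            (ENNReal.ofReal (Real.exp (l * gridMean n s (centerLoop b).1)) +
              ENNReal.ofReal (Real.exp (-l * gridMean n s (centerLoop b).1)))) ∂ν := by
          refine lintegral_mono fun b => ?_
          have h := exp_neg_gridPotential_le hn hε hε1 hr hnr hl0 s (centerLoop b).1
          rw [gridEnergy_centerLoop] at h
          refine (ENNReal.ofReal_le_ofReal h).trans_eq ?_
          rw [ENNReal.ofReal_add (by positivity) (by positivity),
            ENNReal.ofReal_mul (by positivity), ENNReal.ofReal_mul (by positivity),
            ENNReal.ofReal_add (by positivity) (by positivity)]
      _ ≤ ENNReal.ofReal M * ENNReal.ofReal ((√ε)⁻¹ ^ n) +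
          ENNReal.ofReal (Real.exp (-(l * (r / 4)))) *
            (ENNReal.ofReal (Real.exp (l ^ 2 / (2 * n))) +
              ENNReal.ofReal (Real.exp (l ^ 2 / (2 * n)))) := by
          rw [lintegral_add_left (hcE.const_mul _), lintegral_const_mul _ hcE,
            lintegral_const_mul' _ _ ENNReal.ofReal_ne_top, lintegral_add_left (hcM l)]
          gcongr
      _ = _ := by
          rw [← ENNReal.ofReal_add (by positivity) (by positivity),
            ← ENNReal.ofReal_mul (by positivity), ← ENNReal.ofReal_mul (by positivity),
            ← ENNReal.ofReal_add (by positivity) (by positivity)]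
          congr 2
          rw [← two_mul, mul_left_comm, ← Real.exp_add]
          congr 2
          rw [hl]
          field_simp
          ring
  unfold hillIntegral meanZeroCBM
  -- This inequality for the pushforward requires no measurability of the integrand.
  refine (lintegral_map_le _ _).trans ?_
  rw [ENNReal.ofReal_mul (Real.exp_pos _).le]
  calc _ ≤ ∫⁻ b, ENNReal.ofReal (Real.exp (4 + r ^ 2 + 1 / (2 * ε))) *
        ENNReal.ofReal (∫ s in (0 : ℝ)..1, f (s, b)) ∂ν := by
        refine lintegral_mono fun b => ?_
        rw [← ENNReal.ofReal_mul (Real.exp_pos _).le]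
        exact ENNReal.ofReal_le_ofReal (exp_mul_hillA_le hε (r ^ 2) hn (centerLoop b))
    _ = ENNReal.ofReal (Real.exp (4 + r ^ 2 + 1 / (2 * ε))) *
        ∫⁻ b, ENNReal.ofReal (∫ s in (0 : ℝ)..1, f (s, b)) ∂ν :=
        lintegral_const_mul' _ _ ENNReal.ofReal_ne_top
    _ ≤ _ := by
        gcongr
        exact lintegral_ofReal_integral_shift_le hf (fun x => (Real.exp_pos _).le) hshift

/-- One factor 1 - ε is the share of the potential left after absorbing A, the other the
discretisation loss. The bound 1/48 gives n ≥ 2r/ε ≥ 96r, so that a large grid mean costs at least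
3r³. -/
theorem exists_lt_transition_cost {c : ℝ} (hc : c < 8 / 3) :
    ∃ ε : ℝ, 0 < ε ∧ ε ≤ 1 / 48 ∧ c < (1 - ε) * ((1 - ε) * (8 / 3 - 4 * ε ^ 2)) := by
  have h : Filter.Tendsto (fun ε : ℝ => (1 - ε) * ((1 - ε) * (8 / 3 - 4 * ε ^ 2)))
      (nhdsWithin 0 (Set.Ioi 0)) (nhds (8 / 3)) := by
    refine tendsto_nhdsWithin_of_tendsto_nhds ?_
    have : Continuous fun ε : ℝ => (1 - ε) * ((1 - ε) * (8 / 3 - 4 * ε ^ 2)) := by fun_prop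
    simpa using this.tendsto 0
  have h2 := (h.eventually (lt_mem_nhds hc)).and
    (Ioc_mem_nhdsGT (show (0 : ℝ) < 1 / 48 by norm_num))
  obtain ⟨ε, h3, h4⟩ := h2.exists
  exact ⟨ε, h4.1, h4.2, h3⟩

/-- A cubic exponential rate absorbs quadratic and linear corrections. -/
theorem eventually_three_mul_exp_le {a c c' k L : ℝ} (ha : 0 ≤ a) (hk : 0 ≤ k) (hL : 0 ≤ L)
    (hc : c < c') :
    ∀ᶠ r : ℝ in Filter.atTop,
      Real.exp (a + r ^ 2) * (3 * Real.exp (-(c' * r ^ 3) + (L * k * r + L))) ≤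
        Real.exp (-c * r ^ 3) := by
  filter_upwards [Filter.eventually_ge_atTop 1, Filter.eventually_ge_atTop
    ((Real.log 3 + a + L + 1 + L * k) / (c' - c))] with r hr1 hr2
  have hlog : 0 ≤ Real.log 3 := Real.log_nonneg (by norm_num)
  rw [div_le_iff₀ (by linarith)] at hr2
  have h1 : Real.exp (a + r ^ 2) * (3 * Real.exp (-(c' * r ^ 3) + (L * k * r + L))) =
      Real.exp (Real.log 3 + (a + r ^ 2) + (-(c' * r ^ 3) + (L * k * r + L))) := by
    rw [Real.exp_add (Real.log 3 + _), Real.exp_add (Real.log 3), Real.exp_log (by norm_num)]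
    ring
  rw [h1, Real.exp_le_exp]
  have h2 : 1 ≤ r ^ 2 := one_le_pow₀ hr1
  have h3 : L * k * r ≤ L * k * r ^ 2 :=
    mul_le_mul_of_nonneg_left (by nlinarith) (mul_nonneg hL hk)
  have h4 : Real.log 3 + a + L ≤ (Real.log 3 + a + L) * r ^ 2 :=
    le_mul_of_one_le_right (by positivity) h2
  have h5 := mul_le_mul_of_nonneg_right hr2 (sq_nonneg r)
  linarith

theorem IsBrownianBridgeLaw.eventually_hillIntegral_le {ν : Measure C(UnitAddCircle, ℝ)}
    (hν : IsBrownianBridgeLaw ν) {c : ℝ} (hc : c < 8 / 3) :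
    ∀ᶠ r : ℝ in Filter.atTop,
      hillIntegral (meanZeroCBM ν) (r ^ 2) ≤ ENNReal.ofReal (Real.exp (-c * r ^ 3)) := by
  obtain ⟨ε, hε, hε1, hcε⟩ := exists_lt_transition_cost hc
  have hsq : 0 < √ε := Real.sqrt_pos.2 hε
  have hL : 0 ≤ Real.log (√ε)⁻¹ :=
    Real.log_nonneg ((one_le_inv₀ hsq).2 (Real.sqrt_le_one.2 (by linarith)))
  have hexpL : Real.exp (Real.log (√ε)⁻¹) = (√ε)⁻¹ := Real.exp_log (inv_pos.2 hsq)
  have hrate : (1 - ε) * (8 / 3 - 4 * ε ^ 2) ≤ 8 / 3 := by nlinarith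
  -- The threshold 128/(3ε²) gives ε²r/16 ≥ 8/3, so the two transitions are cheaper than the r⁴
  -- alternative.
  filter_upwards [Filter.eventually_gt_atTop 0, Filter.eventually_ge_atTop (128 / (3 * ε ^ 2)),
    eventually_three_mul_exp_le (a := 4 + 1 / (2 * ε)) (k := 2 / ε) (by positivity)
      (by positivity) hL hcε] with r hr hr2 hr3
  -- The grid is as coarse as the action bound permits: n = O(r) keeps the moment ε^(-n/2) at
  -- exp(O(r)).
  obtain ⟨n, hn1, hn2⟩ : ∃ n : ℕ, 2 / ε * r ≤ n ∧ (n : ℝ) ≤ 2 / ε * r + 1 :=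
    ⟨_, Nat.le_ceil _, (Nat.ceil_lt_add_one (by positivity)).le⟩
  have hn : 0 < n := by
    have : 0 < 2 / ε * r := by positivity
    exact_mod_cast this.trans_le hn1
  refine (hν.hillIntegral_le hn hε (by linarith) hr hn1).trans (ENNReal.ofReal_le_ofReal ?_)
  have hmin : min ((1 - ε) * (8 / 3 - 4 * ε ^ 2) * r ^ 3) (ε ^ 2 / 16 * r ^ 4) =
      (1 - ε) * (8 / 3 - 4 * ε ^ 2) * r ^ 3 := by
    refine min_eq_left ?_
    have h1 : 8 / 3 ≤ ε ^ 2 / 16 * r := by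
      rw [div_le_iff₀ (by positivity)] at hr2
      linarith
    calc _ ≤ 8 / 3 * r ^ 3 := by gcongr
      _ ≤ ε ^ 2 / 16 * r * r ^ 3 := by gcongr
      _ = _ := by ring
  have hpow : (√ε)⁻¹ ^ n = Real.exp (n * Real.log (√ε)⁻¹) := by
    rw [Real.exp_nat_mul, hexpL]
  rw [hmin, hpow, ← Real.exp_add]
  generalize Real.log (√ε)⁻¹ = L at *
  generalize hR : (1 - ε) * (8 / 3 - 4 * ε ^ 2) = R at *
  have hR3 : (1 - ε) * R ≤ 3 := by nlinarith
  have hnL : n * L ≤ L * (2 / ε) * r + L := by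
    linarith [mul_le_mul_of_nonneg_right hn2 hL]
  have hLr : 0 ≤ L * (2 / ε) * r := by positivity
  have h1 : -(1 - ε) * (R * r ^ 3) + n * L ≤
      -((1 - ε) * R * r ^ 3) + (L * (2 / ε) * r + L) := by linarith
  have h2 : -(r ^ 2 * n / 32) ≤ -((1 - ε) * R * r ^ 3) + (L * (2 / ε) * r + L) := by
    have h3 : 96 * r ≤ n := by
      refine le_trans (mul_le_mul_of_nonneg_right ?_ hr.le) hn1
      rw [le_div_iff₀ hε]
      linarith
    have h4 := mul_le_mul_of_nonneg_left h3 (sq_nonneg r)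
    have h5 := mul_le_mul_of_nonneg_right hR3 (pow_pos hr 3).le
    linarith
  have h3 : 4 + r ^ 2 + 1 / (2 * ε) = 4 + 1 / (2 * ε) + r ^ 2 := by ring
  refine le_trans ?_ hr3
  rw [h3]
  refine mul_le_mul_of_nonneg_left ?_ (Real.exp_pos _).le
  linarith [Real.exp_le_exp.2 h1, Real.exp_le_exp.2 h2]

theorem theorem2p2 (ν : Measure C(UnitAddCircle, ℝ)) (hν : IsBrownianBridgeLaw ν) :
    Filter.limsup
      (fun μ : ℝ => ((μ ^ (-(3 / 2) : ℝ) : ℝ) : EReal) *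
        ENNReal.log (hillIntegral (meanZeroCBM ν) μ))
      Filter.atTop ≤ ((-(8 / 3) : ℝ) : EReal) := by
  -- It suffices to bound the limsup by each real z > -8/3, which is the eventual bound with c = -z
  -- and r = √μ.
  refine (EReal.le_of_forall_lt_iff_le).1 fun z hz => ?_
  have hc : -z < 8 / 3 := by linarith [EReal.coe_lt_coe_iff.1 hz]
  refine Filter.limsup_le_of_le (by isBoundedDefault) ?_
  filter_upwards [Real.tendsto_sqrt_atTop.eventually (hν.eventually_hillIntegral_le hc),
    Filter.eventually_gt_atTop 0] with μ h hμ
  rw [Real.sq_sqrt hμ.le, neg_neg] at h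
  have hpow : μ ^ (-(3 / 2) : ℝ) = (√μ ^ 3)⁻¹ := by
    rw [Real.rpow_neg hμ.le, Real.sqrt_eq_rpow, ← Real.rpow_natCast, ← Real.rpow_mul hμ.le]
    norm_num
  have hs : 0 < √μ ^ 3 := pow_pos (Real.sqrt_pos.2 hμ) 3
  calc _ ≤ ((μ ^ (-(3 / 2) : ℝ) : ℝ) : EReal) *
        ENNReal.log (ENNReal.ofReal (Real.exp (z * √μ ^ 3))) :=
        mul_le_mul_of_nonneg_left (ENNReal.log_le_log h)
          (EReal.coe_nonneg.2 (Real.rpow_nonneg hμ.le _))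
    _ = (z : EReal) := by
        rw [ENNReal.log_ofReal_of_pos (Real.exp_pos _), Real.log_exp, ← EReal.coe_mul, hpow]
        congr 1
        field_simp
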